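/- Let $n\ge 1$. For a locally integrable $u:\mathbb{R}^n\to\mathbb{R}$ put $$\|u\|_{BV}=\sup\Big\{\Big|\int_{\mathbb{R}^n}u\,\operatorname{div}\phi\,dx\Big| : \phi\in C^1_c(\mathbb{R}^n;\mathbb{R}^n),\ \|\phi\|_{L^\infty}\le 1\Big\},$$ and, for $0<s<1$ and $1\le p<\infty$, $$\|u\|_{\dot W^{s,p}}=\Big(\iint_{\mathbb{R}^{2n}}\frac{|u(x+h)-u(x)|^p}{|h|^{sp+n}}\,dh\,dx\Big)^{1/p}.$$ Let $BV$ and $\dot W^{s,p}$ be the spaces of all locally integrable $u$ for which the corresponding quantity is finite. Let $0<t<1$, $1<q<\infty$ with $t<\frac1q$, let $0<\theta<1$, and let $(p,s)$ be given by $(\frac1p,s)=(1-\theta)(\frac1q,t)+\theta(1,1)$. Then there is a constant $C$, depending only on $n,t,q,\theta$, such that every $u\in BV\cap\dot W^{t,q}$ belongs to $\dot W^{s,p}$ and satisfies $$\|u\|_{\dot W^{s,p}}\le C\,\|u\|_{\dot W^{t,q}}^{1-\theta}\,\|u\|_{BV}^{\theta}.$$ -/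

import Mathlib

open MeasureTheory
open scoped ENNReal NNReal

noncomputable section

/-- Euclidean space `ℝⁿ`, with the Euclidean norm and Lebesgue measure. -/
abbrev Rn (n : ℕ) : Type := EuclideanSpace ℝ (Fin n)

/-- The divergence `∑ᵢ ∂ᵢ φᵢ` of a vector field on `ℝⁿ`. -/
def divergence {n : ℕ} (φ : Rn n → Rn n) (x : Rn n) : ℝ :=
  ∑ i : Fin n, (fderiv ℝ φ x (EuclideanSpace.single i 1)) i

/-- The homogeneous BV (semi)norm: the supremum of `|∫ u div φ|` over compactly supported `C¹`
vector fields `φ` with `‖φ‖_∞ ≤ 1`, as an extended nonnegative real. It is meant for locally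
integrable `u`, for which every integral in the supremum converges absolutely. -/
def bvNorm {n : ℕ} (u : Rn n → ℝ) : ℝ≥0∞ :=
  ⨆ φ ∈ {φ : Rn n → Rn n | ContDiff ℝ 1 φ ∧ HasCompactSupport φ ∧ ∀ x, ‖φ x‖ ≤ 1},
    ENNReal.ofReal |∫ x, u x * divergence φ x|

/-- `u` is (a representative of) an element of the homogeneous space `BV(ℝⁿ)`. -/
def MemBV {n : ℕ} (u : Rn n → ℝ) : Prop :=
  LocallyIntegrable u volume ∧ bvNorm u < ∞

/-- The difference quotient `|u(x+h) - u(x)| / |h|^b`. -/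
def diffQuot {n : ℕ} (b : ℝ) (u : Rn n → ℝ) (x h : Rn n) : ℝ :=
  |u (x + h) - u x| / ‖h‖ ^ b

/-- The homogeneous fractional Sobolev (Gagliardo) (semi)norm
`(∬ |u(x+h) - u(x)|^p / |h|^(s p + n) dh dx)^(1/p)`, as an extended nonnegative real. -/
def sobolevNorm {n : ℕ} (s p : ℝ) (u : Rn n → ℝ) : ℝ≥0∞ :=
  (∫⁻ z : Rn n × Rn n, ENNReal.ofReal (diffQuot (s + n / p) u z.1 z.2 ^ p)) ^ (1 / p)

/-- `u` is (a representative of) an element of the homogeneous fractional Sobolev space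
`Ẇ^{s,p}(ℝⁿ)`, for `0 < s < 1 ≤ p < ∞`. -/
def MemSobolev {n : ℕ} (s p : ℝ) (u : Rn n → ℝ) : Prop :=
  LocallyIntegrable u volume ∧ sobolevNorm s p u < ∞

end

/-! ### Stopping radii of a finite measure on the line -/

noncomputable section

open MeasureTheory Set Metric
open scoped ENNReal NNReal

/-! Put `a = (1 - t q) / (q - 1)`, which is positive because `t < 1 / q`. The points `(1/q, t)`,
`(1/p, s)` and `(1, 1)` lie on the line `s p - 1 = a (1 - p)`. Hence, with `F(x, h) = |h|^a |u(x+h)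
- u(x)|` and `dν = |h|^(-a-1-n) dx dh`, both Sobolev norms are norms of the same function: in
`L^q(ν)` and in `L^p(ν)`. At the endpoint `(1, 1)` the `L¹(ν)` norm is in general infinite, but BV
controls the weak norm: `l ν{F > l} ≤ C ‖u‖_BV`. The claim is then interpolation between weak `L¹`
and `L^q`.

The weak bound reduces to the line. Mollification reduces it to `C¹` functions, polar coordinates in
`h` to a fixed direction, and averaging over translates to a single line. There an increment is at
most the mass of an interval under the measure `μ = |v'| dt`, so it remains to prove
`exists_lintegral_heavyRadii_le`. With `R(x)` the infimum of the heavy radii, the inner integral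
there is at most a multiple of `R(x)^(-a-1)`. The lower bound `le_lintegral_stopRadius` and Fubini
then bound the integral of this power by `μ(ℝ) / l`. -/

/-- Radii at which the `a`-weighted mass of the centred interval exceeds `l`. -/
def heavyRadii (μ : Measure ℝ) (a l : ℝ) (x : ℝ) : Set ℝ :=
  {r | 0 < r ∧ l < r ^ a * μ.real (closedBall x r)}

/-- The infimum of the heavy radii. -/
def stopRadius (μ : Measure ℝ) (a l : ℝ) (x : ℝ) : ℝ := sInf (heavyRadii μ a l x)

lemma heavyRadii_bddBelow (μ : Measure ℝ) (a l x : ℝ) : BddBelow (heavyRadii μ a l x) := ⟨0, fun _ h => h.1.le⟩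

section StopRadius
variable {μ : Measure ℝ} [IsFiniteMeasure μ] {a l : ℝ}

/-- Enlarging the radius by the distance between the centres keeps the old ball inside the new one.
Hence the stopping radius is 1-Lipschitz, and heavy radii exist at every point or at none. -/
lemma heavyRadii_add {x y r : ℝ} (ha : 0 < a) (hr : r ∈ heavyRadii μ a l y) :
    r + |x - y| ∈ heavyRadii μ a l x := by
  obtain ⟨h0, h1⟩ := hr
  refine ⟨by positivity, h1.trans_le ?_⟩
  have := abs_nonneg (x - y)
  gcongr
  · linarith
  · exact measure_ne_top _ _
  · apply closedBall_subset_closedBall'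
    rw [Real.dist_eq, abs_sub_comm]

lemma exists_pos_le_heavyRadii (ha : 0 < a) (hl : 0 < l) :
    ∃ δ > 0, ∀ x, ∀ r ∈ heavyRadii μ a l x, δ ≤ r := by
  have hm : 0 ≤ μ.real univ := measureReal_nonneg
  have hq : 0 < l / (μ.real univ + 1) := by positivity
  refine ⟨(l / (μ.real univ + 1)) ^ (1 / a), by positivity, fun x r hr => ?_⟩
  by_contra! hlt
  have h1 : r ^ a ≤ l / (μ.real univ + 1) := by
    calc r ^ a ≤ ((l / (μ.real univ + 1)) ^ (1 / a)) ^ a :=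
          Real.rpow_le_rpow hr.1.le hlt.le ha.le
      _ = _ := by rw [← Real.rpow_mul hq.le, one_div_mul_cancel ha.ne', Real.rpow_one]
  have h2 : μ.real (closedBall x r) ≤ μ.real univ + 1 :=
    (measureReal_mono (subset_univ _)).trans (by linarith)
  have h3 : r ^ a * μ.real (closedBall x r) ≤ l / (μ.real univ + 1) * (μ.real univ + 1) := by
    gcongr
  rw [div_mul_cancel₀ _ (by positivity)] at h3
  linarith [hr.2]

lemma stopRadius_pos (ha : 0 < a) (hl : 0 < l) {x : ℝ} (hne : (heavyRadii μ a l x).Nonempty) :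
    0 < stopRadius μ a l x := by
  obtain ⟨δ, hδ, h⟩ := exists_pos_le_heavyRadii (μ := μ) ha hl
  exact hδ.trans_le (le_csInf hne (h x))

lemma stopRadius_le_add (ha : 0 < a) (hne : ∀ x, (heavyRadii μ a l x).Nonempty) (x y : ℝ) :
    stopRadius μ a l x ≤ stopRadius μ a l y + |x - y| := by
  rw [← sub_le_iff_le_add]
  refine le_csInf (hne y) fun r hr => ?_
  rw [sub_le_iff_le_add]
  exact csInf_le (heavyRadii_bddBelow μ a l x) (heavyRadii_add ha hr)

lemma continuous_stopRadius (ha : 0 < a) (hne : ∀ x, (heavyRadii μ a l x).Nonempty) :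
    Continuous (stopRadius μ a l) := by
  refine (LipschitzWith.of_le_add fun x y => ?_).continuous (K := 1)
  rw [Real.dist_eq]
  exact stopRadius_le_add ha hne x y

/-- The infimum itself need not be heavy; doubling it leaves room for a heavy radius below. -/
lemma le_measure_closedBall_two_stopRadius (ha : 0 < a) (hl : 0 < l) {x : ℝ}
    (hne : (heavyRadii μ a l x).Nonempty) :
    l ≤ (2 * stopRadius μ a l x) ^ a * μ.real (closedBall x (2 * stopRadius μ a l x)) := by
  have hR := stopRadius_pos ha hl hne
  obtain ⟨r, hr, hlt⟩ := exists_lt_of_csInf_lt hne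
    (show stopRadius μ a l x < 2 * stopRadius μ a l x by linarith)
  have := hr.1
  refine hr.2.le.trans ?_
  gcongr
  exact measure_ne_top _ _

/-- This takes the place of a covering argument. The radius may be far smaller at points near `x`,
so the mass is taken around an almost minimal point `z`, near which `R` cannot drop below half of `R
z`. -/
lemma le_lintegral_stopRadius (ha : 0 < a) (hl : 0 < l)
    (hne : ∀ x, (heavyRadii μ a l x).Nonempty) (x : ℝ) :
    ENNReal.ofReal (l / 4 ^ a) ≤
      ∫⁻ y in closedBall x (4 * stopRadius μ a l x), ENNReal.ofReal (stopRadius μ a l y ^ a) ∂μ := by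
  set R := stopRadius μ a l with hRdef
  have hpos : ∀ y, 0 < R y := fun y => stopRadius_pos ha hl (hne y)
  have hcont : Continuous R := continuous_stopRadius ha hne
  -- The penalty slope 1/4 gives `R y ≥ R z - |y - z| / 4`, hence `R y ≥ R z / 2` when `|y - z| ≤ 2
  -- R z`. Comparison with `y = x` gives `|z - x| ≤ 4 (R x - R z)`.
  obtain ⟨z, hz⟩ : ∃ z, ∀ y, R z + |z - x| / 4 ≤ R y + |y - x| / 4 := by
    refine Continuous.exists_forall_le (by fun_prop) ?_
    have h1 : Filter.Tendsto (fun y : ℝ => dist y x / 4) (Filter.cocompact ℝ) Filter.atTop :=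
      (tendsto_dist_right_cocompact_atTop x).atTop_div_const (by norm_num)
    refine Filter.tendsto_atTop_mono (fun y => ?_) h1
    rw [Real.dist_eq]; linarith [hpos y]
  have hzx := hz x
  simp only [sub_self, abs_zero, zero_div, add_zero] at hzx
  have hlow : ∀ y ∈ closedBall z (2 * R z), R z / 2 ≤ R y := by
    intro y hy
    rw [mem_closedBall, Real.dist_eq] at hy
    have := abs_sub_le y z x
    linarith [hz y]
  have hsub : closedBall z (2 * R z) ⊆ closedBall x (4 * R x) := by
    apply closedBall_subset_closedBall'
    rw [Real.dist_eq]
    linarith [hpos z]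
  have hmass := le_measure_closedBall_two_stopRadius ha hl (hne z)
  rw [← hRdef] at hmass
  calc ENNReal.ofReal (l / 4 ^ a)
      ≤ ENNReal.ofReal ((R z / 2) ^ a * μ.real (closedBall z (2 * R z))) := by
        apply ENNReal.ofReal_le_ofReal
        rw [div_le_iff₀ (by positivity)]
        refine hmass.trans_eq ?_
        rw [mul_right_comm, ← Real.mul_rpow (by linarith [hpos z]) (by norm_num)]
        congr 2; ring
    _ = ENNReal.ofReal ((R z / 2) ^ a) * μ (closedBall z (2 * R z)) := by
        rw [ENNReal.ofReal_mul (Real.rpow_nonneg (by linarith [hpos z]) _), ofReal_measureReal]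
    _ = ∫⁻ y in closedBall z (2 * R z), ENNReal.ofReal ((R z / 2) ^ a) ∂μ := by
        rw [setLIntegral_const]
    _ ≤ ∫⁻ y in closedBall z (2 * R z), ENNReal.ofReal (R y ^ a) ∂μ := by
        refine setLIntegral_mono' measurableSet_closedBall fun y hy => ?_
        apply ENNReal.ofReal_le_ofReal
        exact Real.rpow_le_rpow (by linarith [hpos z]) (hlow y hy) ha.le
    _ ≤ _ := lintegral_mono_set hsub

end StopRadius
end

/-! ### The weak-type estimate on the line -/

noncomputable section

open MeasureTheory Set Metric
open scoped ENNReal NNReal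

lemma lintegral_Ici_rpow {c a : ℝ} (hc : 0 < c) (ha : 0 < a) :
    ∫⁻ r in Ici c, ENNReal.ofReal (r ^ (-a - 2)) = ENNReal.ofReal (c ^ (-a - 1) / (a + 1)) := by
  rw [setLIntegral_congr Ioi_ae_eq_Ici.symm, ← ofReal_integral_eq_lintegral_ofReal
    (integrableOn_Ioi_rpow_of_lt (by linarith) hc),
    integral_Ioi_rpow_of_lt (by linarith) hc]
  · congr 1
    rw [show -a - 2 + 1 = -(a + 1) by ring, div_neg, neg_div, neg_neg]
    congr 2; ring
  · filter_upwards [ae_restrict_mem measurableSet_Ioi] with r hr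
    exact Real.rpow_nonneg (hc.trans hr).le _

lemma lintegral_add_abs_rpow {a c : ℝ} (hc : 0 < c) :
    ∫⁻ z : ℝ, ENNReal.ofReal ((c + |z|) ^ (-(a + 1))) =
      ENNReal.ofReal (c ^ (-a)) * ∫⁻ z : ℝ, ENNReal.ofReal ((1 + ‖z‖) ^ (-(a + 1))) := by
  have hm : Measurable fun z : ℝ => ENNReal.ofReal ((c + |z|) ^ (-(a + 1))) := by fun_prop
  conv_lhs => rw [← Real.smul_map_volume_mul_left hc.ne']
  rw [lintegral_smul_measure, lintegral_map hm (by fun_prop), smul_eq_mul,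
    ← lintegral_const_mul' _ _ ENNReal.ofReal_ne_top,
    ← lintegral_const_mul' _ _ ENNReal.ofReal_ne_top]
  congr 1 with z
  rw [← ENNReal.ofReal_mul (abs_nonneg _), ← ENNReal.ofReal_mul (by positivity)]
  congr 1
  rw [abs_mul, abs_of_pos hc, Real.norm_eq_abs, show c + c * |z| = c * (1 + |z|) by ring,
    Real.mul_rpow hc.le (by positivity), ← mul_assoc]
  congr 1
  nth_rw 1 [← Real.rpow_one c]
  rw [← Real.rpow_add hc]
  congr 1; ring

section StopRadius
variable {μ : Measure ℝ} [IsFiniteMeasure μ] {a l : ℝ}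

/-- Where `|y - x| ≤ 4 R x`, the Lipschitz bound gives `R y + |x - y| ≤ 9 R x`, rounded up to 10.
The integrand is thus dominated by a translated kernel, and scaling extracts `R y ^ (-a)`. -/
lemma lintegral_stopRadius_kernel_le (ha : 0 < a) (hl : 0 < l)
    (hne : ∀ x, (heavyRadii μ a l x).Nonempty) (y : ℝ) :
    ∫⁻ x, {x | |y - x| ≤ 4 * stopRadius μ a l x}.indicator
        (fun x => ENNReal.ofReal (stopRadius μ a l x ^ (-(a + 1)))) x ≤
      ENNReal.ofReal (10 ^ (a + 1)) * ENNReal.ofReal (stopRadius μ a l y ^ (-a)) *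
        ∫⁻ z : ℝ, ENNReal.ofReal ((1 + ‖z‖) ^ (-(a + 1))) := by
  set R := stopRadius μ a l with hRdef
  have hpos : ∀ y, 0 < R y := fun y => stopRadius_pos ha hl (hne y)
  calc _ ≤ ∫⁻ x, ENNReal.ofReal (10 ^ (a + 1)) *
          ENNReal.ofReal ((R y + |x - y|) ^ (-(a + 1))) := by
        refine lintegral_mono fun x => ?_
        dsimp only
        rw [indicator_apply]
        split_ifs with hx
        swap
        · exact bot_le
        rw [← ENNReal.ofReal_mul (by positivity)]
        apply ENNReal.ofReal_le_ofReal
        have h1 : R y ≤ R x + |y - x| := stopRadius_le_add ha hne y x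
        have h2 : |y - x| ≤ 4 * R x := hx
        have h3 : R y + |x - y| ≤ 10 * R x := by rw [abs_sub_comm x y]; linarith [hpos x]
        have h4 : 0 < R y + |x - y| := by have := hpos y; positivity
        have h5 := Real.rpow_le_rpow_of_nonpos h4 h3 (show -(a + 1) ≤ 0 by linarith)
        rw [Real.mul_rpow (by norm_num) (hpos x).le] at h5
        calc R x ^ (-(a + 1)) = 10 ^ (a + 1) * (10 ^ (-(a + 1)) * R x ^ (-(a + 1))) := by
              rw [← mul_assoc, ← Real.rpow_add (by norm_num)]; simp
          _ ≤ _ := by gcongr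
    _ = _ := by
        rw [lintegral_const_mul' _ _ ENNReal.ofReal_ne_top,
          lintegral_sub_right_eq_self (fun z => ENNReal.ofReal ((R y + |z|) ^ (-(a + 1)))) y,
          lintegral_add_abs_rpow (hpos y), mul_assoc]

/-- Insert the lower bound for the mass near `x` and exchange integrals: the weight `R y ^ a`
cancels the `R y ^ (-a)` from the kernel, leaving only the total mass. -/
lemma lintegral_stopRadius_rpow_le (ha : 0 < a) (hl : 0 < l)
    (hne : ∀ x, (heavyRadii μ a l x).Nonempty) :
    ENNReal.ofReal (l / 4 ^ a) * ∫⁻ x, ENNReal.ofReal (stopRadius μ a l x ^ (-(a + 1))) ≤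
      ENNReal.ofReal (10 ^ (a + 1)) * (∫⁻ z : ℝ, ENNReal.ofReal ((1 + ‖z‖) ^ (-(a + 1)))) *
        μ univ := by
  set R := stopRadius μ a l with hRdef
  have hpos : ∀ y, 0 < R y := fun y => stopRadius_pos ha hl (hne y)
  have hcont : Continuous R := continuous_stopRadius ha hne
  set K := ∫⁻ z : ℝ, ENNReal.ofReal ((1 + ‖z‖) ^ (-(a + 1))) with hK
  have hS : MeasurableSet {z : ℝ × ℝ | |z.2 - z.1| ≤ 4 * R z.1} :=
    measurableSet_le (by fun_prop) (by fun_prop)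
  have hm : Measurable (fun z : ℝ × ℝ => {z : ℝ × ℝ | |z.2 - z.1| ≤ 4 * R z.1}.indicator
      (fun z => ENNReal.ofReal (R z.1 ^ (-(a + 1))) * ENNReal.ofReal (R z.2 ^ a)) z) := by
    refine Measurable.indicator ?_ hS
    have := hcont.measurable
    fun_prop
  rw [← lintegral_const_mul' _ _ ENNReal.ofReal_ne_top]
  calc ∫⁻ x, ENNReal.ofReal (l / 4 ^ a) * ENNReal.ofReal (R x ^ (-(a + 1)))
      ≤ ∫⁻ x, ∫⁻ y, {z : ℝ × ℝ | |z.2 - z.1| ≤ 4 * R z.1}.indicator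
          (fun z => ENNReal.ofReal (R z.1 ^ (-(a + 1))) * ENNReal.ofReal (R z.2 ^ a)) (x, y) ∂μ := by
        refine lintegral_mono fun x => ?_
        dsimp only
        rw [mul_comm]
        calc _ ≤ ENNReal.ofReal (R x ^ (-(a + 1))) *
              ∫⁻ y in closedBall x (4 * R x), ENNReal.ofReal (R y ^ a) ∂μ := by
              gcongr; exact le_lintegral_stopRadius ha hl hne x
          _ = _ := by
              rw [← lintegral_const_mul' _ _ ENNReal.ofReal_ne_top,
                ← lintegral_indicator measurableSet_closedBall]
              congr 1 with y
    _ = ∫⁻ y, ∫⁻ x, {z : ℝ × ℝ | |z.2 - z.1| ≤ 4 * R z.1}.indicator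
          (fun z => ENNReal.ofReal (R z.1 ^ (-(a + 1))) * ENNReal.ofReal (R z.2 ^ a)) (x, y) ∂volume ∂μ :=
        lintegral_lintegral_swap hm.aemeasurable
    _ ≤ ∫⁻ y, ENNReal.ofReal (10 ^ (a + 1)) * K ∂μ := by
        refine lintegral_mono fun y => ?_
        dsimp only
        calc _ = ENNReal.ofReal (R y ^ a) * ∫⁻ x, {x | |y - x| ≤ 4 * R x}.indicator
              (fun x => ENNReal.ofReal (R x ^ (-(a + 1)))) x := by
              rw [← lintegral_const_mul' _ _ ENNReal.ofReal_ne_top]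
              congr 1 with x
              simp only [indicator, mem_ofPred_eq]
              split_ifs
              · rw [mul_comm]
              · simp
          _ ≤ ENNReal.ofReal (R y ^ a) *
              (ENNReal.ofReal (10 ^ (a + 1)) * ENNReal.ofReal (R y ^ (-a)) * K) := by
              gcongr
              exact lintegral_stopRadius_kernel_le ha hl hne y
          _ = ENNReal.ofReal (R y ^ a * R y ^ (-a)) * (ENNReal.ofReal (10 ^ (a + 1)) * K) := by
              rw [ENNReal.ofReal_mul (Real.rpow_nonneg (hpos y).le _)]; ring
          _ ≤ _ := by
              rw [← Real.rpow_add (hpos y)]; simp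
    _ = _ := by rw [lintegral_const]

end StopRadius

/-- One-dimensional weak-type estimate: the heavy intervals of a finite measure, counted with the
density `r ^ (-a - 2)`, have total mass controlled by `μ(ℝ) / l`. -/
theorem exists_lintegral_heavyRadii_le {a : ℝ} (ha : 0 < a) :
    ∃ C : ℝ≥0, ∀ (μ : Measure ℝ) [IsFiniteMeasure μ] (l : ℝ), 0 < l →
      ENNReal.ofReal l * ∫⁻ x, ∫⁻ r in heavyRadii μ a l x, ENNReal.ofReal (r ^ (-a - 2)) ≤
        C * μ univ := by
  set K := ∫⁻ z : ℝ, ENNReal.ofReal ((1 + ‖z‖) ^ (-(a + 1))) with hK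
  have hKtop : K < ∞ := finite_integral_one_add_norm (by simpa using ha)
  refine ⟨(ENNReal.ofReal (4 ^ a) * (ENNReal.ofReal (10 ^ (a + 1)) * K)).toNNReal, ?_⟩
  intro μ _ l hl
  rw [ENNReal.coe_toNNReal (by finiteness)]
  -- One heavy radius anywhere makes every point have one; otherwise the left side vanishes.
  by_cases hne : ∃ x, (heavyRadii μ a l x).Nonempty
  · obtain ⟨x₀, r₀, hr₀⟩ := hne
    have hne : ∀ x, (heavyRadii μ a l x).Nonempty := fun x => ⟨_, heavyRadii_add ha hr₀⟩
    have key := lintegral_stopRadius_rpow_le ha hl hne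
    rw [← hK] at key
    have h1 : ∫⁻ x, ∫⁻ r in heavyRadii μ a l x, ENNReal.ofReal (r ^ (-a - 2)) ≤
        ∫⁻ x, ENNReal.ofReal (stopRadius μ a l x ^ (-(a + 1))) := by
      refine lintegral_mono fun x => ?_
      have hx := stopRadius_pos ha hl (hne x)
      calc _ ≤ ∫⁻ r in Ici (stopRadius μ a l x), ENNReal.ofReal (r ^ (-a - 2)) :=
            lintegral_mono_set fun r hr => csInf_le (heavyRadii_bddBelow μ a l x) hr
        _ = ENNReal.ofReal (stopRadius μ a l x ^ (-a - 1) / (a + 1)) := lintegral_Ici_rpow hx ha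
        _ ≤ _ := by
            apply ENNReal.ofReal_le_ofReal
            rw [show -(a + 1) = -a - 1 by ring]
            exact div_le_self (Real.rpow_nonneg hx.le _) (by linarith)
    calc _ ≤ ENNReal.ofReal l * ∫⁻ x, ENNReal.ofReal (stopRadius μ a l x ^ (-(a + 1))) := by gcongr
      _ = ENNReal.ofReal (4 ^ a) * (ENNReal.ofReal (l / 4 ^ a) *
            ∫⁻ x, ENNReal.ofReal (stopRadius μ a l x ^ (-(a + 1)))) := by
          rw [← mul_assoc, ← ENNReal.ofReal_mul (by positivity), mul_div_cancel₀ _ (by positivity)]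
      _ ≤ ENNReal.ofReal (4 ^ a) * (ENNReal.ofReal (10 ^ (a + 1)) * K * μ univ) := by gcongr
      _ = _ := by ring
  · push Not at hne
    simp [hne]
end

/-! ### Increments in a fixed direction -/

noncomputable section

open MeasureTheory Set Metric
open scoped ENNReal NNReal

section increments
variable {E : Type*} [NormedAddCommGroup E] [NormedSpace ℝ E]

/-- The pairs `(x, r)`, `0 < r < L`, at which the increment of `v` in the direction `r • w`
exceeds `l / r ^ a`. -/
def largeIncrements (v : E → ℝ) (w : E) (a l L : ℝ) : Set (E × ℝ) :=
  {z | 0 < z.2 ∧ z.2 < L ∧ l < z.2 ^ a * |v (z.1 + z.2 • w) - v z.1|}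

lemma enorm_sub_le_lintegral_fderiv {v : E → ℝ} (hv : ContDiff ℝ 1 v) (x w : E) {b c : ℝ}
    (hbc : b ≤ c) :
    ‖v (x + c • w) - v (x + b • w)‖ₑ ≤ ∫⁻ t in Ioc b c, ‖fderiv ℝ v (x + t • w) w‖ₑ := by
  have hc : Continuous fun t : ℝ => fderiv ℝ v (x + t • w) w :=
    ((hv.continuous_fderiv (by norm_num)).comp (by fun_prop)).clm_apply continuous_const
  have hd : ∀ t : ℝ, HasDerivAt (fun t : ℝ => v (x + t • w)) (fderiv ℝ v (x + t • w) w) t := by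
    intro t
    have h1 : HasDerivAt (fun t : ℝ => x + t • w) w t := by
      simpa using ((hasDerivAt_id t).smul_const w).const_add x
    exact ((hv.differentiable (by norm_num)) _).hasFDerivAt.comp_hasDerivAt t h1
  rw [← intervalIntegral.integral_eq_sub_of_hasDerivAt (fun t _ => hd t)
    (hc.intervalIntegrable b c), intervalIntegral.integral_of_le hbc]
  exact enorm_integral_le_lintegral_enorm _

variable [MeasurableSpace E] [BorelSpace E]

lemma measurableSet_largeIncrements {v : E → ℝ} (hv : Continuous v) (w : E) (a l L : ℝ) :
    MeasurableSet (largeIncrements v w a l L) := by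
  have h1 : Measurable fun z : E × ℝ => v (z.1 + z.2 • w) := by
    have : Continuous fun z : E × ℝ => v (z.1 + z.2 • w) := by fun_prop
    exact this.measurable
  have h2 : Measurable fun z : E × ℝ => v z.1 := hv.measurable.comp measurable_fst
  have h3 : Measurable fun z : E × ℝ => z.2 ^ a * |v (z.1 + z.2 • w) - v z.1| :=
    (by fun_prop : Measurable fun z : E × ℝ => z.2 ^ a).mul (h1.sub h2).abs
  exact (measurableSet_lt measurable_const measurable_snd).inter
    ((measurableSet_lt measurable_snd measurable_const).inter
      (measurableSet_lt measurable_const h3))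

/-- Weak-type estimate for the increments of a `C¹` function in a fixed direction, deduced from the
estimate on lines by averaging over translations along the direction. -/
theorem exists_lintegral_largeIncrements_le (ν : Measure E) [SFinite ν] [ν.IsAddRightInvariant]
    {a : ℝ} (ha : 0 < a) :
    ∃ C : ℝ≥0, ∀ (v : E → ℝ) (w : E) (l L : ℝ), ContDiff ℝ 1 v → 0 < l → 0 < L →
      ENNReal.ofReal l * ∫⁻ x, ∫⁻ r, (largeIncrements v w a l L).indicator
          (fun z => ENNReal.ofReal (z.2 ^ (-a - 2))) (x, r) ∂volume ∂ν ≤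
        C * ∫⁻ x, ‖fderiv ℝ v x w‖ₑ ∂ν := by
  obtain ⟨C, hC⟩ := exists_lintegral_heavyRadii_le ha
  refine ⟨3 * C, fun v w l L hv hl hL => ?_⟩
  set F : E × ℝ → ℝ≥0∞ := (largeIncrements v w a l L).indicator
    (fun z => ENNReal.ofReal (z.2 ^ (-a - 2))) with hF
  have hFm : Measurable F := by
    refine Measurable.indicator ?_ (measurableSet_largeIncrements hv.continuous w a l L)
    fun_prop
  set Φ : E → ℝ≥0∞ := fun x => ∫⁻ r, F (x, r) with hΦ
  have hΦm : Measurable Φ := hFm.lintegral_prod_right'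
  have hgc : Continuous fun x => fderiv ℝ v x w :=
    (hv.continuous_fderiv (by norm_num)).clm_apply continuous_const
  set g : E → ℝ≥0∞ := fun x => ‖fderiv ℝ v x w‖ₑ with hg
  have hgm : Measurable g := hgc.measurable.enorm
  have hshift : Measurable fun z : E × ℝ => z.1 + z.2 • w :=
    (by fun_prop : Continuous fun z : E × ℝ => z.1 + z.2 • w).measurable
  -- Increments of length below `L` starting at `t ∈ (0, L)` only see the derivative on `[-L, 2L]`;
  -- on this compact interval its mass is finite, as the line estimate requires.
  have hline : ∀ x, ENNReal.ofReal l * ∫⁻ t in Ioo 0 L, Φ (x + t • w) ≤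
      C * ∫⁻ t in Icc (-L) (2 * L), g (x + t • w) := by
    intro x
    have hgxm : Measurable fun t : ℝ => g (x + t • w) :=
      hgm.comp (by fun_prop : Continuous fun t : ℝ => x + t • w).measurable
    set μ : Measure ℝ := (volume.restrict (Icc (-L) (2 * L))).withDensity fun t => g (x + t • w)
      with hμ
    have : IsFiniteMeasure μ := by
      refine isFiniteMeasure_withDensity ?_
      have h1 : Continuous fun t : ℝ => fderiv ℝ v (x + t • w) w := hgc.comp (by fun_prop)
      exact (h1.continuousOn.integrableOn_Icc (μ := volume) (a := -L) (b := 2 * L)).2.ne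
    have huniv : μ univ = ∫⁻ t in Icc (-L) (2 * L), g (x + t • w) := by
      rw [hμ, withDensity_apply _ MeasurableSet.univ, Measure.restrict_univ]
    rw [← huniv]
    refine le_trans ?_ (hC μ l hl)
    gcongr ENNReal.ofReal l * ?_
    refine (lintegral_mono_ae ?_).trans (setLIntegral_le_lintegral (Ioo 0 L) _)
    filter_upwards [ae_restrict_mem measurableSet_Ioo] with t ht
    have hsec : MeasurableSet {r | (x + t • w, r) ∈ largeIncrements v w a l L} :=
      measurable_prodMk_left (measurableSet_largeIncrements hv.continuous w a l L)
    calc Φ (x + t • w) = ∫⁻ r in {r | (x + t • w, r) ∈ largeIncrements v w a l L},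
          ENNReal.ofReal (r ^ (-a - 2)) := by
          rw [← lintegral_indicator hsec]; rfl
      _ ≤ _ := by
          refine lintegral_mono_set fun r hr => ?_
          obtain ⟨h0, h1, h2⟩ := hr
          refine ⟨h0, h2.trans_le ?_⟩
          dsimp only
          gcongr
          rw [← ENNReal.ofReal_le_ofReal_iff measureReal_nonneg, ofReal_measureReal,
            ← Real.enorm_eq_ofReal_abs, add_assoc, ← add_smul]
          dsimp only at h0 h1
          refine (enorm_sub_le_lintegral_fderiv hv x w (by linarith)).trans ?_
          have hsub : Ioc t (t + r) ⊆ Icc (-L) (2 * L) := fun s hs =>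
            ⟨by linarith [hs.1, ht.1], by linarith [hs.2, ht.2]⟩
          have hsub' : Ioc t (t + r) ⊆ closedBall t r := fun s hs => by
            rw [mem_closedBall, Real.dist_eq, abs_of_nonneg (by linarith [hs.1])]
            linarith [hs.2]
          calc _ = μ (Ioc t (t + r)) := by
                rw [hμ, withDensity_apply _ measurableSet_Ioc,
                  Measure.restrict_restrict measurableSet_Ioc, inter_eq_left.2 hsub]
            _ ≤ _ := measure_mono hsub'
  have htrans : ∀ (G : E → ℝ≥0∞) (s : Set ℝ), Measurable G →
      ∫⁻ x, ∫⁻ t in s, G (x + t • w) ∂volume ∂ν = volume s * ∫⁻ x, G x ∂ν := by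
    intro G s hG
    rw [lintegral_lintegral_swap (f := fun x (t : ℝ) => G (x + t • w)) (hG.comp hshift).aemeasurable]
    simp only [lintegral_add_right_eq_self G]
    rw [lintegral_const, Measure.restrict_apply_univ, mul_comm]
  -- By translation invariance, integrating over `x` turns the parameter intervals into factors `L`
  -- and `3 L`. Cancelling `L` leaves the constant `3 * C`, independent of `L`.
  have hint := lintegral_mono (μ := ν) hline
  rw [lintegral_const_mul' _ _ ENNReal.ofReal_ne_top,
    lintegral_const_mul' _ _ ENNReal.coe_ne_top, htrans Φ _ hΦm, htrans g _ hgm,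
    Real.volume_Ioo, Real.volume_Icc, show 2 * L - -L = 3 * L by ring, sub_zero,
    ENNReal.ofReal_mul (by norm_num)] at hint
  have hL0 : ENNReal.ofReal L ≠ 0 := by simpa using hL
  rw [← ENNReal.mul_le_mul_iff_right hL0 ENNReal.ofReal_ne_top]
  calc _ = ENNReal.ofReal l * (ENNReal.ofReal L * ∫⁻ x, Φ x ∂ν) := by ring
    _ ≤ _ := hint
    _ = _ := by simp only [ENNReal.ofReal_ofNat]; push_cast; ring

end increments
end

/-! ### Mollification of BV functions -/

noncomputable section

open MeasureTheory Set Metric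
open scoped ENNReal NNReal Convolution Pointwise

section bv
variable {n : ℕ}

lemma divergence_smul_const {ψ : Rn n → ℝ} (hψ : ContDiff ℝ 1 ψ) (w x : Rn n) :
    divergence (fun y => ψ y • w) x = fderiv ℝ ψ x w := by
  have hd : DifferentiableAt ℝ ψ x := hψ.differentiable (by norm_num) x
  unfold divergence
  rw [fderiv_smul_const hd]
  conv_rhs => rw [← (EuclideanSpace.basisFun (Fin n) ℝ).sum_repr w]
  simp [mul_comm]

lemma ofReal_abs_integral_mul_fderiv_le_bvNorm (u : Rn n → ℝ) {ψ : Rn n → ℝ} {w : Rn n}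
    (hψ : ContDiff ℝ 1 ψ) (hc : HasCompactSupport ψ) (h1 : ∀ x, |ψ x| ≤ 1) (hw : ‖w‖ ≤ 1) :
    ENNReal.ofReal |∫ x, u x * fderiv ℝ ψ x w| ≤ bvNorm u := by
  have hmem : (fun y => ψ y • w) ∈ {φ : Rn n → Rn n | ContDiff ℝ 1 φ ∧ HasCompactSupport φ ∧
      ∀ x, ‖φ x‖ ≤ 1} := by
    refine ⟨hψ.smul contDiff_const, hc.smul_right, fun x => ?_⟩
    rw [norm_smul, Real.norm_eq_abs]
    exact mul_le_one₀ (h1 x) (norm_nonneg _) hw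
  rw [bvNorm]
  have := le_iSup₂ (f := fun (φ : Rn n → Rn n) (_ : φ ∈ {φ : Rn n → Rn n | ContDiff ℝ 1 φ ∧
    HasCompactSupport φ ∧ ∀ x, ‖φ x‖ ≤ 1}) => ENNReal.ofReal |∫ x, u x * divergence φ x|) _ hmem
  simpa only [divergence_smul_const hψ] using this

lemma fderiv_convolution_apply {f η : Rn n → ℝ} (hf : LocallyIntegrable f) (hη : ContDiff ℝ 1 η)
    (hc : HasCompactSupport η) (x w : Rn n) :
    fderiv ℝ (f ⋆[ContinuousLinearMap.lsmul ℝ ℝ, volume] η) x w =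
      ∫ t, f t * fderiv ℝ η (x - t) w := by
  rw [(hc.hasFDerivAt_convolution_right _ hf hη x).fderiv,
    convolution_precompR_apply _ hf (hc.fderiv ℝ) (hη.continuous_fderiv (by norm_num))]
  rfl

lemma fderiv_comp_neg_apply {η : Rn n → ℝ} (hη : ContDiff ℝ 1 η) (x w : Rn n) :
    fderiv ℝ (fun y => η (-y)) x w = - fderiv ℝ η (-x) w := by
  have h2 : HasFDerivAt η (fderiv ℝ η (-x)) (-x) := (hη.differentiable (by norm_num) _).hasFDerivAt
  have h3 := h2.comp x (hasFDerivAt_id (𝕜 := ℝ) x).neg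
  have h4 : fderiv ℝ (fun y => η (-y)) x = _ := h3.fderiv
  rw [h4]
  simp

/-- This justifies Fubini when the convolution is moved from `u` to the test function: compact
supports confine `u` to a compact set, where it is integrable. -/
lemma integrable_mul_mul_sub {σ u D : Rn n → ℝ} {B : Set (Rn n)} (hB : IsCompact B)
    (hσ : Integrable σ) (hσB : ∀ x, x ∉ B → σ x = 0) (hu : LocallyIntegrable u)
    (hD : Continuous D) (hDs : HasCompactSupport D) :
    Integrable (fun z : Rn n × Rn n => σ z.1 * (u z.2 * D (z.1 - z.2)))
      (volume.prod volume) := by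
  obtain ⟨M, hM⟩ := hDs.exists_bound_of_continuous hD
  set K : Set (Rn n) := B + -tsupport D with hK
  have hKc : IsCompact K := hB.add hDs.isCompact.neg
  have hui : Integrable (K.indicator fun t => ‖u t‖) :=
    (integrable_indicator_iff hKc.measurableSet).2 (hu.integrableOn_isCompact hKc).norm
  refine Integrable.mono' ((hσ.norm.mul_prod hui).const_mul M) ?_ ?_
  · refine AEStronglyMeasurable.mul hσ.aestronglyMeasurable.comp_fst ?_
    refine AEStronglyMeasurable.mul hu.aestronglyMeasurable.comp_snd ?_
    exact (hD.comp (continuous_fst.sub continuous_snd)).aestronglyMeasurable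
  · refine ae_of_all _ fun z => ?_
    have hM0 : 0 ≤ M := (norm_nonneg _).trans (hM 0)
    have hnn : 0 ≤ K.indicator (fun t => ‖u t‖) z.2 := indicator_nonneg (fun _ _ => norm_nonneg _) _
    by_cases hz : σ z.1 * D (z.1 - z.2) = 0
    · rw [mul_left_comm, hz, mul_zero, norm_zero]
      positivity
    · rw [mul_eq_zero, not_or] at hz
      have hzB : z.1 ∈ B := by
        by_contra h; exact hz.1 (hσB _ h)
      have hzK : z.2 ∈ K := ⟨z.1, hzB, z.2 - z.1,
        by rw [mem_neg, neg_sub]; exact subset_tsupport _ hz.2, by simp⟩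
      rw [indicator_of_mem hzK, norm_mul, norm_mul]
      calc ‖σ z.1‖ * (‖u z.2‖ * ‖D (z.1 - z.2)‖)
          ≤ ‖σ z.1‖ * (‖u z.2‖ * M) := by gcongr; exact hM _
        _ = _ := by ring

lemma ofReal_abs_integral_mul_fderiv_convolution_le {u η σ : Rn n → ℝ} (hu : LocallyIntegrable u)
    (hη : ContDiff ℝ 1 η) (hc : HasCompactSupport η) (h0 : ∀ x, 0 ≤ η x) (h1 : ∫ x, η x = 1)
    {w : Rn n} (hw : ‖w‖ ≤ 1) {B : Set (Rn n)} (hB : IsCompact B)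
    (hσ : Integrable σ) (hσB : ∀ x, x ∉ B → σ x = 0) (hσ1 : ∀ x, |σ x| ≤ 1) :
    ENNReal.ofReal |∫ x, σ x *
      fderiv ℝ (u ⋆[ContinuousLinearMap.lsmul ℝ ℝ, volume] η) x w| ≤ bvNorm u := by
  have hDc : Continuous fun y => fderiv ℝ η y w :=
    (hη.continuous_fderiv (by norm_num)).clm_apply continuous_const
  have hDs : HasCompactSupport fun y => fderiv ℝ η y w := hc.fderiv_apply ℝ w
  have hσs : HasCompactSupport σ := HasCompactSupport.intro hB hσB
  have hη'd : ContDiff ℝ 1 fun y => η (-y) := hη.comp contDiff_neg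
  have hη'c : HasCompactSupport fun y => η (-y) := hc.comp_homeomorph (Homeomorph.neg _)
  -- Convolving with the reflected mollifier is the adjoint operation. It makes the merely bounded
  -- `σ` into an admissible test function, with bound 1 because `η` has mass 1.
  obtain ⟨ψ, hψ⟩ : ∃ ψ, ψ = σ ⋆[ContinuousLinearMap.lsmul ℝ ℝ, volume] fun y => η (-y) := ⟨_, rfl⟩
  have hψd : ContDiff ℝ 1 ψ := by
    rw [hψ]
    exact hη'c.contDiff_convolution_right (n := 1) _ hσ.locallyIntegrable hη'd
  have hψc : HasCompactSupport ψ := by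
    rw [hψ]
    exact hσs.convolution _ hη'c
  have hψ1 : ∀ t, |ψ t| ≤ 1 := by
    intro t
    have hηi : Integrable fun x => η (-(t - x)) :=
      (hη'd.continuous.integrable_of_hasCompactSupport hη'c).comp_sub_left t
    calc |ψ t| ≤ ∫ x, η (-(t - x)) := by
          rw [hψ, convolution_def, ← Real.norm_eq_abs]
          refine norm_integral_le_of_norm_le hηi (ae_of_all _ fun x => ?_)
          change ‖σ x * η (-(t - x))‖ ≤ _
          rw [norm_mul, Real.norm_of_nonneg (h0 _)]
          exact mul_le_of_le_one_left (h0 _) (hσ1 x)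
      _ = 1 := by
          rw [← h1, integral_sub_left_eq_self (fun y => η (-y)) volume t]
          exact integral_neg_eq_self η volume
  have hψf : ∀ t, fderiv ℝ ψ t w = - ∫ x, σ x * fderiv ℝ η (x - t) w := by
    intro t
    rw [hψ, fderiv_convolution_apply hσ.locallyIntegrable hη'd hη'c, ← integral_neg]
    congr 1 with x
    rw [fderiv_comp_neg_apply hη, neg_sub]; ring
  have hkey : ∫ x, σ x * fderiv ℝ (u ⋆[ContinuousLinearMap.lsmul ℝ ℝ, volume] η) x w =
      - ∫ t, u t * fderiv ℝ ψ t w := by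
    calc _ = ∫ x, ∫ t, σ x * (u t * fderiv ℝ η (x - t) w) := by
          congr 1 with x
          rw [fderiv_convolution_apply hu hη hc, integral_const_mul]
      _ = ∫ t, ∫ x, σ x * (u t * fderiv ℝ η (x - t) w) :=
          integral_integral_swap (integrable_mul_mul_sub hB hσ hσB hu hDc hDs)
      _ = _ := by
          rw [← integral_neg]
          congr 1 with t
          rw [hψf, mul_neg, neg_neg, ← integral_const_mul]
          congr 1 with x
          ring
  rw [hkey, abs_neg]
  exact ofReal_abs_integral_mul_fderiv_le_bvNorm u hψd hψc hψ1 hw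

/-- The directional derivative of a mollification of `u` is bounded in `L¹` by `bvNorm u`. -/
theorem lintegral_fderiv_convolution_le_bvNorm {u η : Rn n → ℝ} (hu : LocallyIntegrable u)
    (hη : ContDiff ℝ 1 η) (hc : HasCompactSupport η) (h0 : ∀ x, 0 ≤ η x) (h1 : ∫ x, η x = 1)
    {w : Rn n} (hw : ‖w‖ ≤ 1) :
    ∫⁻ x, ‖fderiv ℝ (u ⋆[ContinuousLinearMap.lsmul ℝ ℝ, volume] η) x w‖ₑ ≤ bvNorm u := by
  have hv : ContDiff ℝ 1 (u ⋆[ContinuousLinearMap.lsmul ℝ ℝ, volume] η) :=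
    hc.contDiff_convolution_right (n := 1) _ hu hη
  have hgc : Continuous fun x => fderiv ℝ (u ⋆[ContinuousLinearMap.lsmul ℝ ℝ, volume] η) x w :=
    (hv.continuous_fderiv (by norm_num)).clm_apply continuous_const
  have hmain := fun σ B =>
    ofReal_abs_integral_mul_fderiv_convolution_le (σ := σ) (B := B) hu hη hc h0 h1 hw
  generalize hg : (fun x => fderiv ℝ (u ⋆[ContinuousLinearMap.lsmul ℝ ℝ, volume] η) x w) = g at hgc
  simp only [fun x => show fderiv ℝ (u ⋆[ContinuousLinearMap.lsmul ℝ ℝ, volume] η) x w = g x from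
    congrFun hg x] at hmain ⊢
  have hball : ∀ k : ℕ, ∫⁻ x in closedBall 0 (k : ℝ), ‖g x‖ₑ ≤ bvNorm u := by
    intro k
    set B : Set (Rn n) := closedBall 0 (k : ℝ) with hB
    have hBm : MeasurableSet B := measurableSet_closedBall
    have hBc : IsCompact B := isCompact_closedBall _ _
    -- The sign of `g`, cut off to a ball, recovers the `L¹` norm of `g` there by duality.
    set σ : Rn n → ℝ := B.indicator fun x => if 0 ≤ g x then 1 else -1 with hσ
    have hσm : Measurable σ := by
      refine Measurable.indicator ?_ hBm
      exact Measurable.ite (measurableSet_le measurable_const hgc.measurable) measurable_const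
        measurable_const
    have hσB : ∀ x, x ∉ B → σ x = 0 := fun x hx => indicator_of_notMem hx _
    have hσ1 : ∀ x, |σ x| ≤ B.indicator (fun _ => (1 : ℝ)) x := by
      intro x
      simp only [hσ, indicator]
      split_ifs <;> simp
    have hσle : ∀ x, |σ x| ≤ 1 := by
      intro x
      simp only [hσ, indicator]
      split_ifs <;> simp
    have hσi : Integrable σ := by
      refine Integrable.mono' ((integrable_indicator_iff hBm).2
        (integrableOn_const (C := (1 : ℝ)) hBc.measure_lt_top.ne)) hσm.aestronglyMeasurable ?_
      exact ae_of_all _ hσ1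
    have hkey : ∫ x in B, ‖g x‖ = ∫ x, σ x * g x := by
      rw [← integral_indicator hBm]
      congr 1 with x
      simp only [hσ, indicator]
      split_ifs with hx hgx
      · rw [one_mul, Real.norm_of_nonneg hgx]
      · rw [Real.norm_of_nonpos (not_le.1 hgx).le]; ring
      · simp
    have hgi : IntegrableOn g B := hgc.continuousOn.integrableOn_compact hBc
    calc ∫⁻ x in B, ‖g x‖ₑ = ENNReal.ofReal (∫ x in B, ‖g x‖) := by
          rw [ofReal_integral_norm_eq_lintegral_enorm hgi]
      _ ≤ ENNReal.ofReal |∫ x, σ x * g x| := by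
          rw [hkey]; exact ENNReal.ofReal_le_ofReal (le_abs_self _)
      _ ≤ bvNorm u := hmain σ B hBc hσi hσB hσle
  rw [← setLIntegral_univ, ← iUnion_closedBall_nat (0 : Rn n), setLIntegral_iUnion_of_directed]
  · exact iSup_le hball
  · exact directed_of_isDirected_le fun i j hij => closedBall_subset_closedBall (by exact_mod_cast hij)

end bv
end

/-! ### Polar coordinates and the weak-type estimate for BV -/

noncomputable section

open MeasureTheory Set Metric Filter Topology
open scoped ENNReal NNReal Convolution

/-- Integration in polar coordinates. -/
theorem lintegral_eq_lintegral_toSphere {E : Type*} [NormedAddCommGroup E] [NormedSpace ℝ E]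
    [MeasurableSpace E] [BorelSpace E] [FiniteDimensional ℝ E] [Nontrivial E] (μ : Measure E)
    [μ.IsAddHaarMeasure] {f : E → ℝ≥0∞} (hf : Measurable f) :
    ∫⁻ h, f h ∂μ = ∫⁻ w : sphere (0 : E) 1, ∫⁻ r in Ioi (0 : ℝ),
      ENNReal.ofReal (r ^ (Module.finrank ℝ E - 1)) * f (r • (w : E)) ∂volume ∂μ.toSphere := by
  have hg : Measurable fun z : sphere (0 : E) 1 × Ioi (0 : ℝ) => f ((z.2 : ℝ) • (z.1 : E)) :=
    hf.comp (by fun_prop : Continuous fun z : sphere (0 : E) 1 × Ioi (0 : ℝ) =>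
      (z.2 : ℝ) • (z.1 : E)).measurable
  calc ∫⁻ h, f h ∂μ = ∫⁻ h : ({0}ᶜ : Set E), f h ∂(μ.comap (↑)) := by
        rw [lintegral_subtype_comap (measurableSet_singleton _).compl, restrict_compl_singleton]
    _ = ∫⁻ z, f ((z.2 : ℝ) • (z.1 : E)) ∂(μ.toSphere.prod
          (Measure.volumeIoiPow (Module.finrank ℝ E - 1))) := by
        rw [← μ.measurePreserving_homeomorphUnitSphereProd.lintegral_comp hg]
        congr 1 with h
        congr 1
        have := congrArg Subtype.val ((homeomorphUnitSphereProd E).symm_apply_apply h)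
        rw [homeomorphUnitSphereProd_symm_apply_coe] at this
        exact this.symm
    _ = _ := by
        rw [lintegral_prod _ hg.aemeasurable]
        congr 1 with w
        rw [Measure.volumeIoiPow, lintegral_withDensity_eq_lintegral_mul _ (by fun_prop)
          (show Measurable fun r : Ioi (0 : ℝ) => f ((r : ℝ) • (w : E)) from
            hg.comp measurable_prodMk_left)]
        exact lintegral_subtype_comap measurableSet_Ioi
          fun r : ℝ => ENNReal.ofReal (r ^ (Module.finrank ℝ E - 1)) * f (r • (w : E))

section weak
variable {n : ℕ}

/-- The pairs `(x, h)` at which `|u (x + h) - u x|` exceeds `l / ‖h‖ ^ a`. -/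
def largeDifferences (u : Rn n → ℝ) (a l : ℝ) : Set (Rn n × Rn n) :=
  {z | l < ‖z.2‖ ^ a * |u (z.1 + z.2) - u z.1|}

lemma measurableSet_largeDifferences {v : Rn n → ℝ} (hv : Continuous v) (a l : ℝ) :
    MeasurableSet (largeDifferences v a l) := by
  have := hv.measurable
  exact measurableSet_lt measurable_const (by fun_prop)

/-- In polar coordinates `r^(n-1) r^(-a-1-n) = r^(-a-2)`, the density of the directional estimate.
Integrating over directions costs the area of the sphere. -/
theorem exists_lintegral_largeDifferences_le_of_contDiff (hn : 1 ≤ n) {a : ℝ} (ha : 0 < a) :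
    ∃ C : ℝ≥0, ∀ (v : Rn n → ℝ) (l L : ℝ) (M : ℝ≥0∞), ContDiff ℝ 1 v → 0 < l → 0 < L →
      (∀ w : Rn n, ‖w‖ ≤ 1 → ∫⁻ x, ‖fderiv ℝ v x w‖ₑ ≤ M) →
      ENNReal.ofReal l * ∫⁻ z, (largeDifferences v a l ∩ {z | ‖z.2‖ < L}).indicator
        (fun z => ENNReal.ofReal (‖z.2‖ ^ (-a - 1 - n))) z ≤ C * M := by
  obtain ⟨C, hC⟩ := exists_lintegral_largeIncrements_le (volume : Measure (Rn n)) ha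
  have : Nonempty (Fin n) := ⟨⟨0, hn⟩⟩
  have hdim : Module.finrank ℝ (Rn n) = n := finrank_euclideanSpace_fin
  refine ⟨C * ((volume : Measure (Rn n)).toSphere univ).toNNReal, ?_⟩
  intro v l L M hv hl hL hM
  set F : Rn n × Rn n → ℝ≥0∞ := (largeDifferences v a l ∩ {z | ‖z.2‖ < L}).indicator
        (fun z => ENNReal.ofReal (‖z.2‖ ^ (-a - 1 - n))) with hF
  have hFm : Measurable F := by
    refine Measurable.indicator (by fun_prop) ((measurableSet_largeDifferences hv.continuous a l).inter ?_)
    exact measurableSet_lt (by fun_prop) measurable_const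
  have hdir : ∀ w : sphere (0 : Rn n) 1, ENNReal.ofReal l * ∫⁻ r in Ioi (0 : ℝ),
      ENNReal.ofReal (r ^ (Module.finrank ℝ (Rn n) - 1)) * ∫⁻ x, F (x, r • (w : Rn n)) ≤
        C * M := by
    intro w
    have hw : ‖(w : Rn n)‖ = 1 := norm_eq_of_mem_sphere w
    set G : Rn n × ℝ → ℝ≥0∞ := (largeIncrements v (w : Rn n) a l L).indicator
          (fun z => ENNReal.ofReal (z.2 ^ (-a - 2))) with hG
    have hGm : Measurable G :=
      Measurable.indicator (by fun_prop) (measurableSet_largeIncrements hv.continuous _ a l L)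
    calc _ ≤ ENNReal.ofReal l * ∫⁻ r in Ioi (0 : ℝ), ∫⁻ x, G (x, r) := by
          gcongr ENNReal.ofReal l * ?_
          refine setLIntegral_mono' measurableSet_Ioi fun r hr => ?_
          have hr0 : 0 < r := hr
          rw [← lintegral_const_mul' _ _ ENNReal.ofReal_ne_top]
          refine lintegral_mono fun x => ?_
          have hnorm : ‖r • (w : Rn n)‖ = r := by
            rw [norm_smul, hw, mul_one, Real.norm_of_nonneg hr0.le]
          by_cases hx : (x, r • (w : Rn n)) ∈ largeDifferences v a l ∩ {z | ‖z.2‖ < L}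
          · have hx' : (x, r) ∈ largeIncrements v (w : Rn n) a l L := by
              obtain ⟨h1, h2⟩ := hx
              simp only [largeDifferences, mem_ofPred_eq, hnorm] at h1 h2
              exact ⟨hr0, h2, h1⟩
            simp only [hF, hG]
            rw [indicator_of_mem hx, indicator_of_mem hx']
            simp only [hnorm]
            rw [← ENNReal.ofReal_mul (by positivity), hdim, ← Real.rpow_natCast,
              ← Real.rpow_add hr0]
            apply le_of_eq
            congr 2
            push_cast [Nat.cast_sub hn]
            ring
          · simp only [hF]
            rw [indicator_of_notMem hx, mul_zero]
            exact bot_le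
      _ ≤ ENNReal.ofReal l * ∫⁻ r, ∫⁻ x, G (x, r) := by
          gcongr; exact Measure.restrict_le_self
      _ = ENNReal.ofReal l * ∫⁻ x, ∫⁻ r, G (x, r) := by
          rw [lintegral_lintegral_swap (f := fun x r => G (x, r)) hGm.aemeasurable]
      _ ≤ C * ∫⁻ x, ‖fderiv ℝ v x w‖ₑ := hC v w l L hv hl hL
      _ ≤ _ := by gcongr; exact hM _ hw.le
  have hpolar := lintegral_eq_lintegral_toSphere (volume : Measure (Rn n))
    (f := fun h => ∫⁻ x, F (x, h)) hFm.lintegral_prod_left'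
  rw [Measure.volume_eq_prod, lintegral_prod_symm _ hFm.aemeasurable, hpolar,
    ← lintegral_const_mul' _ _ ENNReal.ofReal_ne_top]
  refine (lintegral_mono hdir).trans ?_
  rw [lintegral_const, ENNReal.coe_mul, ENNReal.coe_toNNReal (measure_ne_top _ _)]
  apply le_of_eq
  ring

lemma aemeasurable_norm_rpow_mul_abs_sub {u : Rn n → ℝ} (hu : LocallyIntegrable u) (a : ℝ) :
    AEMeasurable (fun z : Rn n × Rn n => ‖z.2‖ ^ a * |u (z.1 + z.2) - u z.1|) := by
  have h1 : AEMeasurable (fun z : Rn n × Rn n => u (z.1 + z.2)) :=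
    hu.aestronglyMeasurable.aemeasurable.comp_quasiMeasurePreserving
      (Measure.quasiMeasurePreserving_fst.comp
        (measurePreserving_add_prod volume volume).quasiMeasurePreserving)
  have h2 : AEMeasurable (fun z : Rn n × Rn n => u z.1) :=
    hu.aestronglyMeasurable.aemeasurable.comp_quasiMeasurePreserving
      Measure.quasiMeasurePreserving_fst
  exact (by fun_prop : Measurable fun z : Rn n × Rn n => ‖z.2‖ ^ a).aemeasurable.mul
    (h1.sub h2).abs

lemma exists_mollifiers {u : Rn n → ℝ} (hu : LocallyIntegrable u) :
    ∃ v : ℕ → Rn n → ℝ, (∀ k, ContDiff ℝ 1 (v k)) ∧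
      (∀ k w, ‖w‖ ≤ 1 → ∫⁻ x, ‖fderiv ℝ (v k) x w‖ₑ ≤ bvNorm u) ∧
      ∀ᵐ x, Tendsto (fun k => v k x) atTop (𝓝 (u x)) := by
  have hpos : ∀ k : ℕ, (0 : ℝ) < 1 / (k + 1) := fun k => Nat.one_div_pos_of_nat
  -- The ratio of outer to inner radius stays equal to 2, as Lebesgue differentiation needs for
  -- almost everywhere convergence.
  let φ : ℕ → ContDiffBump (0 : Rn n) := fun k =>
    ⟨1 / (k + 1), 2 * (1 / (k + 1)), hpos k, by linarith [hpos k]⟩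
  have hφ : Tendsto (fun k => (φ k).rOut) atTop (𝓝 0) := by
    have h := (tendsto_one_div_add_atTop_nhds_zero_nat (𝕜 := ℝ)).const_mul 2
    rwa [mul_zero] at h
  have hae := ContDiffBump.ae_convolution_tendsto_right_of_locallyIntegrable (μ := volume)
    hφ (Eventually.of_forall fun k => le_refl (2 * (φ k).rIn)) hu
  refine ⟨fun k => u ⋆[ContinuousLinearMap.lsmul ℝ ℝ, volume] (φ k).normed volume,
    fun k => ?_, fun k w hw => ?_, ?_⟩
  · exact (φ k).hasCompactSupport_normed.contDiff_convolution_right (n := 1) _ hu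
      (φ k).contDiff_normed
  · exact lintegral_fderiv_convolution_le_bvNorm hu ((φ k).contDiff_normed (n := 1))
      (φ k).hasCompactSupport_normed (φ k).nonneg_normed (φ k).integral_normed hw
  · filter_upwards [hae] with x hx
    refine hx.congr fun k => ?_
    rw [convolution_lsmul_swap, convolution_lsmul]
    simp only [smul_eq_mul, mul_comm]

/-- Weak-type estimate for the difference quotients of a function of bounded variation. -/
theorem exists_lintegral_largeDifferences_le (hn : 1 ≤ n) {a : ℝ} (ha : 0 < a) :
    ∃ C : ℝ≥0, ∀ (u : Rn n → ℝ) (l : ℝ), LocallyIntegrable u → 0 < l →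
      ENNReal.ofReal l * ∫⁻ z, (largeDifferences u a l).indicator
        (fun z => ENNReal.ofReal (‖z.2‖ ^ (-a - 1 - n))) z ≤ C * bvNorm u := by
  obtain ⟨C, hC⟩ := exists_lintegral_largeDifferences_le_of_contDiff hn ha
  refine ⟨C, fun u l hu hl => ?_⟩
  obtain ⟨v, hvd, hvM, hvu⟩ := exists_mollifiers hu
  set F : ℕ → Rn n × Rn n → ℝ≥0∞ := fun k =>
    (largeDifferences (v k) a l ∩ {z | ‖z.2‖ < (k : ℝ) + 1}).indicator
        (fun z => ENNReal.ofReal (‖z.2‖ ^ (-a - 1 - n))) with hF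
  have hFm : ∀ k, Measurable (F k) := fun k => by
    refine Measurable.indicator (by fun_prop)
      ((measurableSet_largeDifferences (hvd k).continuous a l).inter ?_)
    exact measurableSet_lt (by fun_prop) measurable_const
  have hFk : ∀ k, ∫⁻ z, F k z ≤ C * bvNorm u / ENNReal.ofReal l := by
    intro k
    rw [ENNReal.le_div_iff_mul_le (Or.inl (by simpa using hl)) (Or.inl ENNReal.ofReal_ne_top),
      mul_comm]
    exact hC (v k) l (k + 1) _ (hvd k) hl (by positivity) (hvM k)
  have hcv1 : ∀ᵐ z : Rn n × Rn n, Tendsto (fun k => v k z.1) atTop (𝓝 (u z.1)) :=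
    Measure.quasiMeasurePreserving_fst.ae hvu
  have hcv2 : ∀ᵐ z : Rn n × Rn n,
      Tendsto (fun k => v k (z.1 + z.2)) atTop (𝓝 (u (z.1 + z.2))) :=
    (Measure.quasiMeasurePreserving_fst.comp
        (measurePreserving_add_prod volume volume).quasiMeasurePreserving).ae hvu
  rw [mul_comm, ← ENNReal.le_div_iff_mul_le (Or.inl (by simpa using hl))
    (Or.inl ENNReal.ofReal_ne_top)]
  -- Fatou: the strict inequality defining the set passes to the mollifications for large `k`, and
  -- the cutoff `k + 1` eventually exceeds `‖z.2‖`.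
  calc _ ≤ ∫⁻ z, liminf (fun k => F k z) atTop := by
        refine lintegral_mono_ae ?_
        filter_upwards [hcv1, hcv2] with z h1 h2
        by_cases hz : z ∈ largeDifferences u a l
        · rw [indicator_of_mem hz]
          refine le_liminf_of_le (by isBoundedDefault) ?_
          have h3 : Tendsto (fun k => ‖z.2‖ ^ a * |v k (z.1 + z.2) - v k z.1|) atTop
              (𝓝 (‖z.2‖ ^ a * |u (z.1 + z.2) - u z.1|)) := ((h2.sub h1).abs).const_mul _
          filter_upwards [h3.eventually_const_lt hz, eventually_ge_atTop ⌈‖z.2‖⌉₊] with k hk hk2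
          have hk3 : ‖z.2‖ < (k : ℝ) + 1 := by
            have := Nat.ceil_le.1 hk2
            linarith
          have hmem : z ∈ largeDifferences (v k) a l ∩ {z | ‖z.2‖ < (k : ℝ) + 1} := ⟨hk, hk3⟩
          simp only [hF]
          rw [indicator_of_mem hmem]
        · rw [indicator_of_notMem hz]
          exact bot_le
    _ ≤ liminf (fun k => ∫⁻ z, F k z) atTop := lintegral_liminf_le hFm
    _ ≤ liminf (fun _ : ℕ => C * bvNorm u / ENNReal.ofReal l) atTop :=
        liminf_le_liminf (Eventually.of_forall hFk)
    _ = _ := liminf_const _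

end weak
end

/-! ### Interpolation between weak `L¹` and `L^q` -/

noncomputable section

open MeasureTheory Set Filter Topology
open scoped ENNReal NNReal

section interpolation

lemma lintegral_Ioo_rpow {T p : ℝ} (hT : 0 < T) (hp : 1 < p) :
    ∫⁻ t in Ioo 0 T, ENNReal.ofReal (t ^ (p - 2)) = ENNReal.ofReal (T ^ (p - 1) / (p - 1)) := by
  rw [setLIntegral_congr Ioo_ae_eq_Ioc, ← ofReal_integral_eq_lintegral_ofReal,
    ← intervalIntegral.integral_of_le hT.le, integral_rpow (Or.inl (by linarith)),
    show p - 2 + 1 = p - 1 by ring, Real.zero_rpow (by linarith), sub_zero]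
  · exact (intervalIntegral.intervalIntegrable_rpow' (by linarith)).1
  · filter_upwards [ae_restrict_mem measurableSet_Ioc] with t ht
    exact Real.rpow_nonneg ht.1.le _

variable {α : Type*} [MeasurableSpace α] {ν : Measure α} {F : α → ℝ} {A : ℝ≥0∞} {p q : ℝ}

/-- Layer-cake formula: the weak bound leaves `p t^(p-2) A`, integrable at 0 because `p > 1`, and
truncation stops the integral at `T`. -/
lemma lintegral_min_rpow_le (hF : AEMeasurable F ν) (h0 : ∀ x, 0 ≤ F x) (hp : 1 < p)
    (hA : ∀ l : ℝ, 0 < l → ENNReal.ofReal l * ν {x | l < F x} ≤ A) {T : ℝ} (hT : 0 < T) :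
    ∫⁻ x, ENNReal.ofReal (min (F x) T ^ p) ∂ν ≤ ENNReal.ofReal (p / (p - 1) * T ^ (p - 1)) * A := by
  rw [lintegral_rpow_eq_lintegral_meas_lt_mul ν (ae_of_all _ fun x => le_min (h0 x) hT.le)
    (hF.min aemeasurable_const) (by linarith)]
  have h1 : ∫⁻ t in Ioi (0 : ℝ), ν {x | t < min (F x) T} * ENNReal.ofReal (t ^ (p - 1)) ≤
      ∫⁻ t in Ioi (0 : ℝ), (Iio T).indicator (fun t => ENNReal.ofReal (t ^ (p - 2)) * A) t := by
    refine setLIntegral_mono' measurableSet_Ioi fun t ht => ?_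
    have ht0 : 0 < t := ht
    by_cases htT : t < T
    · rw [indicator_of_mem (show t ∈ Iio T from htT)]
      calc ν {x | t < min (F x) T} * ENNReal.ofReal (t ^ (p - 1))
          = ENNReal.ofReal (t ^ (p - 2)) * (ENNReal.ofReal t * ν {x | t < min (F x) T}) := by
            rw [← mul_assoc, ← ENNReal.ofReal_mul (by positivity), mul_comm]
            congr 2
            nth_rw 3 [← Real.rpow_one t]
            rw [← Real.rpow_add ht0]
            congr 1; ring
        _ ≤ ENNReal.ofReal (t ^ (p - 2)) * (ENNReal.ofReal t * ν {x | t < F x}) := by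
            gcongr
            exact min_le_left _ _
        _ ≤ _ := by gcongr; exact hA t ht0
    · have : {x | t < min (F x) T} = ∅ := by
        ext x
        simp only [mem_ofPred_eq, mem_empty_iff_false, iff_false, not_lt]
        exact (min_le_right _ _).trans (not_lt.1 htT)
      rw [this]
      simp
  calc _ ≤ ENNReal.ofReal p * ∫⁻ t in Ioi (0 : ℝ),
        (Iio T).indicator (fun t => ENNReal.ofReal (t ^ (p - 2)) * A) t := by gcongr
    _ = ENNReal.ofReal p * ((∫⁻ t in Ioo 0 T, ENNReal.ofReal (t ^ (p - 2))) * A) := by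
        rw [setLIntegral_indicator measurableSet_Iio, Iio_inter_Ioi,
          lintegral_mul_const _ (by fun_prop)]
    _ = _ := by
        rw [lintegral_Ioo_rpow hT hp, ← mul_assoc, ← ENNReal.ofReal_mul (by linarith)]
        congr 2; ring

lemma lintegral_rpow_le_add (hF : AEMeasurable F ν) (h0 : ∀ x, 0 ≤ F x) (hp : 1 < p) (hpq : p < q)
    (hA : ∀ l : ℝ, 0 < l → ENNReal.ofReal l * ν {x | l < F x} ≤ A) {T : ℝ} (hT : 0 < T) :
    ∫⁻ x, ENNReal.ofReal (F x ^ p) ∂ν ≤ ENNReal.ofReal (p / (p - 1) * T ^ (p - 1)) * A +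
      ENNReal.ofReal (T ^ (p - q)) * ∫⁻ x, ENNReal.ofReal (F x ^ q) ∂ν := by
  calc ∫⁻ x, ENNReal.ofReal (F x ^ p) ∂ν
      ≤ ∫⁻ x, (ENNReal.ofReal (min (F x) T ^ p) +
          ENNReal.ofReal (T ^ (p - q)) * ENNReal.ofReal (F x ^ q)) ∂ν := by
        refine lintegral_mono fun x => ?_
        dsimp only
        rcases le_total (F x) T with h | h
        · rw [min_eq_left h]; exact le_self_add
        · refine le_trans ?_ le_add_self
          rw [← ENNReal.ofReal_mul (by positivity)]
          apply ENNReal.ofReal_le_ofReal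
          have hx : 0 < F x := hT.trans_le h
          calc F x ^ p = F x ^ (p - q) * F x ^ q := by
                rw [← Real.rpow_add hx]; congr 1; ring
            _ ≤ T ^ (p - q) * F x ^ q := by
                gcongr ?_ * _
                exact Real.rpow_le_rpow_of_nonpos hT h (by linarith)
    _ = ∫⁻ x, ENNReal.ofReal (min (F x) T ^ p) ∂ν +
          ENNReal.ofReal (T ^ (p - q)) * ∫⁻ x, ENNReal.ofReal (F x ^ q) ∂ν := by
        rw [lintegral_add_left' (((hF.min aemeasurable_const).pow_const p).ennreal_ofReal),
          lintegral_const_mul' _ _ ENNReal.ofReal_ne_top]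
    _ ≤ _ := by gcongr; exact lintegral_min_rpow_le hF h0 hp hA hT

lemma ENNReal.eq_zero_of_forall_le_ofReal_rpow_neg_mul {X D : ℝ≥0∞} {c e : ℝ} (he : 0 < e)
    (hD : D ≠ ∞) (h : ∀ T : ℝ, 0 < T → X ≤ ENNReal.ofReal (c * T ^ (-e)) * D) : X = 0 := by
  have h1 : Tendsto (fun T : ℝ => ENNReal.ofReal (c * T ^ (-e)) * D) atTop (𝓝 0) := by
    have h2 := ENNReal.tendsto_ofReal ((tendsto_rpow_neg_atTop he).const_mul c)
    have h3 := ENNReal.Tendsto.mul_const h2 (Or.inr hD)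
    simpa using h3
  exact le_antisymm (ge_of_tendsto h1 (by filter_upwards [eventually_gt_atTop 0] using h)) bot_le

/-- Interpolation between weak `L¹` and `L^q`. -/
theorem lintegral_rpow_le_of_weak_type (hF : AEMeasurable F ν) (h0 : ∀ x, 0 ≤ F x) (hp : 1 < p)
    (hpq : p < q) {κ : ℝ} (hκ : p - 1 = (q - 1) * κ)
    (hA : ∀ l : ℝ, 0 < l → ENNReal.ofReal l * ν {x | l < F x} ≤ A) (hA' : A ≠ ∞)
    (hB' : ∫⁻ x, ENNReal.ofReal (F x ^ q) ∂ν ≠ ∞) :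
    ∫⁻ x, ENNReal.ofReal (F x ^ p) ∂ν ≤ ENNReal.ofReal (p / (p - 1) + 1) *
      (A ^ (1 - κ) * (∫⁻ x, ENNReal.ofReal (F x ^ q) ∂ν) ^ κ) := by
  have key := fun T hT => lintegral_rpow_le_add (T := T) hF h0 hp hpq hA hT
  generalize (∫⁻ x, ENNReal.ofReal (F x ^ q) ∂ν) = B at key hB' ⊢
  generalize (∫⁻ x, ENNReal.ofReal (F x ^ p) ∂ν) = X at key ⊢
  rcases eq_or_ne A 0 with rfl | hA0
  · have : X = 0 := by
      refine ENNReal.eq_zero_of_forall_le_ofReal_rpow_neg_mul (c := 1) (e := q - p)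
        (by linarith) hB' fun T hT => ?_
      simpa using key T hT
    rw [this]; exact bot_le
  rcases eq_or_ne B 0 with rfl | hB0
  · have : X = 0 := by
      refine ENNReal.eq_zero_of_forall_le_ofReal_rpow_neg_mul (c := p / (p - 1)) (e := p - 1)
        (by linarith) hA' fun T hT => ?_
      -- With `B = 0` the level must tend to 0, so the limit lemma at infinity is applied to the
      -- inverse level.
      have := key T⁻¹ (by positivity)
      rwa [mul_zero, add_zero, Real.inv_rpow hT.le, ← Real.rpow_neg hT.le] at this
    rw [this]; exact bot_le
  obtain ⟨a, ha, rfl⟩ : ∃ a : ℝ, 0 < a ∧ A = ENNReal.ofReal a :=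
    ⟨A.toReal, ENNReal.toReal_pos hA0 hA', (ENNReal.ofReal_toReal hA').symm⟩
  obtain ⟨b, hb, rfl⟩ : ∃ b : ℝ, 0 < b ∧ B = ENNReal.ofReal b :=
    ⟨B.toReal, ENNReal.toReal_pos hB0 hB', (ENNReal.ofReal_toReal hB').symm⟩
  have hq : 0 < q - 1 := by linarith
  have hba : 0 < b / a := by positivity
  -- The level `(b / a) ^ (1 / (q - 1))` balances the two terms: both powers reduce to `a ^ (1 - κ)
  -- * b ^ κ`.
  have hT : 0 < (b / a) ^ (1 / (q - 1)) := by positivity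
  have h1 : ((b / a) ^ (1 / (q - 1))) ^ (p - 1) * a = a ^ (1 - κ) * b ^ κ := by
    rw [← Real.rpow_mul hba.le, show 1 / (q - 1) * (p - 1) = κ by rw [hκ]; field_simp,
      Real.div_rpow hb.le ha.le, Real.rpow_sub ha, Real.rpow_one]
    ring
  have h2 : ((b / a) ^ (1 / (q - 1))) ^ (p - q) * b = a ^ (1 - κ) * b ^ κ := by
    rw [← Real.rpow_mul hba.le,
      show 1 / (q - 1) * (p - q) = κ - 1 by
        rw [show p - q = (q - 1) * κ - (q - 1) by rw [← hκ]; ring]; field_simp,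
      Real.div_rpow hb.le ha.le, ← neg_sub κ 1, Real.rpow_neg ha.le, Real.rpow_sub hb, Real.rpow_one]
    field_simp
  have hp1 : 0 < p - 1 := by linarith
  refine (key _ hT).trans_eq ?_
  rw [ENNReal.ofReal_rpow_of_pos ha, ENNReal.ofReal_rpow_of_pos hb,
    ← ENNReal.ofReal_mul (by positivity), ← ENNReal.ofReal_mul (by positivity),
    ← ENNReal.ofReal_mul (by positivity), ← ENNReal.ofReal_mul (by positivity),
    ← ENNReal.ofReal_add (by positivity) (by positivity), h2, mul_assoc, h1]
  congr 1; ring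

end interpolation

/-! ### The weighted measure and the conclusion -/

section main
variable {n : ℕ}

/-- The measure `‖h‖ ^ (-a - 1 - n) dx dh`. -/
def differenceMeasure (n : ℕ) (a : ℝ) : Measure (Rn n × Rn n) :=
  volume.withDensity fun z => ENNReal.ofReal (‖z.2‖ ^ (-a - 1 - n))

lemma sobolevNorm_eq {u : Rn n → ℝ} (hu : LocallyIntegrable u) {a s p : ℝ} (hp : 0 < p)
    (h : s * p - 1 = a * (1 - p)) :
    sobolevNorm s p u = (∫⁻ z, ENNReal.ofReal ((‖z.2‖ ^ a * |u (z.1 + z.2) - u z.1|) ^ p)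
      ∂differenceMeasure n a) ^ (1 / p) := by
  rw [sobolevNorm, differenceMeasure, lintegral_withDensity_eq_lintegral_mul₀ (by fun_prop)
    ((aemeasurable_norm_rpow_mul_abs_sub hu a).pow_const p).ennreal_ofReal]
  congr 2 with z
  rw [Pi.mul_apply, diffQuot, ← ENNReal.ofReal_mul (by positivity)]
  congr 1
  rcases eq_or_ne z.2 0 with hz | hz
  -- At `h = 0` the difference itself vanishes, so the conventions for powers of 0 do not matter.
  · simp [hz, Real.zero_rpow hp.ne']
  · have hz : 0 < ‖z.2‖ := norm_pos_iff.2 hz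
    rw [Real.div_rpow (abs_nonneg _) (by positivity), Real.mul_rpow (by positivity) (abs_nonneg _),
      ← Real.rpow_mul hz.le, ← Real.rpow_mul hz.le, ← mul_assoc, ← Real.rpow_add hz, div_eq_mul_inv,
      ← Real.rpow_neg hz.le, mul_comm]
    congr 2
    have : (n : ℝ) / p * p = n := div_mul_cancel₀ _ hp.ne'
    linarith

lemma differenceMeasure_largeDifferences {u : Rn n → ℝ} (hu : LocallyIntegrable u) (a l : ℝ) :
    differenceMeasure n a (largeDifferences u a l) = ∫⁻ z, (largeDifferences u a l).indicator
        (fun z => ENNReal.ofReal (‖z.2‖ ^ (-a - 1 - n))) z := by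
  have hm : NullMeasurableSet (largeDifferences u a l) :=
    nullMeasurableSet_lt aemeasurable_const (aemeasurable_norm_rpow_mul_abs_sub hu a)
  rw [differenceMeasure, withDensity_apply₀ _ hm, lintegral_indicator₀ hm]

end main
end

theorem mainTheorem3 (n : ℕ) (hn : 1 ≤ n) (t q θ s p : ℝ)
    (ht0 : 0 < t) (ht1 : t < 1) (hq : 1 < q) (htq : t < 1 / q)
    (hθ0 : 0 < θ) (hθ1 : θ < 1)
    (hsp : ((1 / p, s) : ℝ × ℝ) = (1 - θ) • (1 / q, t) + θ • (1, 1)) :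
    ∃ C : ℝ≥0, ∀ u : Rn n → ℝ, MemBV u → MemSobolev t q u →
      MemSobolev s p u ∧
        sobolevNorm s p u ≤ C * sobolevNorm t q u ^ (1 - θ) * bvNorm u ^ θ := by
  simp only [Prod.smul_mk, Prod.mk_add_mk, Prod.mk.injEq, smul_eq_mul, mul_one] at hsp
  obtain ⟨h1p, hs⟩ := hsp
  have hq0 : 0 < q := by linarith
  have hp0 : 0 < p := by
    rw [← one_div_pos, h1p]
    have : 0 < 1 - θ := by linarith
    positivity
  have hkp : 1 = p * (1 - θ) / q + p * θ := by
    have := congrArg (p * ·) h1p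
    simp only [mul_one_div_cancel hp0.ne'] at this
    linear_combination this
  -- This is the weight with `p = (1 - κ) * 1 + κ * q`; after the `p`-th root, `κ` and `1 - κ`
  -- become `(1 - θ) / q` and `θ`.
  obtain ⟨κ, hκdef⟩ : ∃ κ, κ = p * (1 - θ) / q := ⟨_, rfl⟩
  rw [← hκdef] at hkp
  have hκq : κ * q = p * (1 - θ) := by
    rw [hκdef, div_mul_cancel₀ _ hq0.ne']
  have hκ0 : 0 < κ := by
    have : 0 < 1 - θ := by linarith
    rw [hκdef]
    positivity
  have hκ : p - 1 = (q - 1) * κ := by linear_combination -hκq - hkp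
  have hκ1 : κ < 1 := by nlinarith [mul_pos hp0 hθ0]
  have hp : 1 < p := by nlinarith
  have hpq : p < q := by nlinarith
  have htq1 : t * q < 1 := by rwa [lt_div_iff₀ hq0] at htq
  -- `1 + a` is the slope of the line through `(1/q, t)` and `(1, 1)`.
  obtain ⟨a, hadef⟩ : ∃ a, a = (1 - t * q) / (q - 1) := ⟨_, rfl⟩
  have ha : 0 < a := hadef ▸ div_pos (by linarith) (by linarith)
  have haq : a * (q - 1) = 1 - t * q := by
    rw [hadef, div_mul_cancel₀ _ (by linarith)]
  have hat : t * q - 1 = a * (1 - q) := by linarith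
  have has : s * p - 1 = a * (1 - p) := by
    rw [hs]
    linear_combination -t * hκq - hkp + κ * hat + a * hκ
  obtain ⟨C, hC⟩ := exists_lintegral_largeDifferences_le hn ha
  have hmain : ∀ u : Rn n → ℝ, MemBV u → MemSobolev t q u → sobolevNorm s p u ≤
      (ENNReal.ofReal (p / (p - 1) + 1) ^ (1 / p) * (C : ℝ≥0∞) ^ θ) *
        sobolevNorm t q u ^ (1 - θ) * bvNorm u ^ θ := by
    intro u ⟨hu, hbv⟩ ⟨_, hsob⟩
    rw [sobolevNorm_eq hu hq0 hat] at hsob ⊢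
    rw [sobolevNorm_eq hu hp0 has]
    have hB : ∫⁻ z, ENNReal.ofReal ((‖z.2‖ ^ a * |u (z.1 + z.2) - u z.1|) ^ q)
        ∂differenceMeasure n a ≠ ∞ := by
      intro h
      rw [h, ENNReal.top_rpow_of_pos (by positivity)] at hsob
      exact lt_irrefl _ hsob
    have hint := lintegral_rpow_le_of_weak_type (ν := differenceMeasure n a)
      (F := fun z => ‖z.2‖ ^ a * |u (z.1 + z.2) - u z.1|) (A := C * bvNorm u)
      ((aemeasurable_norm_rpow_mul_abs_sub hu a).mono_ac (withDensity_absolutelyContinuous _ _))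
      (fun z => by positivity) hp hpq hκ
      (fun l hl => by
        have := hC u l hu hl
        rwa [← differenceMeasure_largeDifferences hu] at this)
      (ENNReal.mul_ne_top ENNReal.coe_ne_top hbv.ne) hB
    refine (ENNReal.rpow_le_rpow hint (by positivity)).trans_eq ?_
    have hp1 : (0 : ℝ) ≤ 1 / p := by positivity
    rw [ENNReal.mul_rpow_of_nonneg _ _ hp1, ENNReal.mul_rpow_of_nonneg _ _ hp1,
      ← ENNReal.rpow_mul, ← ENNReal.rpow_mul, ← ENNReal.rpow_mul,
      show (1 - κ) * (1 / p) = θ by rw [show 1 - κ = p * θ by linarith]; field_simp,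
      show κ * (1 / p) = 1 / q * (1 - θ) by rw [hκdef]; field_simp,
      ENNReal.mul_rpow_of_nonneg _ _ hθ0.le]
    ring
  have hCtop : ENNReal.ofReal (p / (p - 1) + 1) ^ (1 / p) * (C : ℝ≥0∞) ^ θ ≠ ∞ :=
    ENNReal.mul_ne_top (ENNReal.rpow_ne_top_of_nonneg (by positivity) ENNReal.ofReal_ne_top)
      (ENNReal.rpow_ne_top_of_nonneg hθ0.le ENNReal.coe_ne_top)
  refine ⟨(ENNReal.ofReal (p / (p - 1) + 1) ^ (1 / p) * (C : ℝ≥0∞) ^ θ).toNNReal,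
    fun u hbv hsob => ?_⟩
  rw [ENNReal.coe_toNNReal hCtop]
  refine ⟨⟨hbv.1, (hmain u hbv hsob).trans_lt ?_⟩, hmain u hbv hsob⟩
  exact ENNReal.mul_lt_top (ENNReal.mul_lt_top hCtop.lt_top
    (ENNReal.rpow_lt_top_of_nonneg (by linarith) hsob.2.ne))
    (ENNReal.rpow_lt_top_of_nonneg hθ0.le hbv.2.ne)
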